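/- All graphs are finite, simple and undirected, with at least one vertex. For a connected graph $G$ write $d_G(u,v)$ for the length of a shortest path between $u$ and $v$, $e_G(v)=\max_{u} d_G(u,v)$ for the eccentricity of a vertex $v$, and $\mathrm{diam}(G)$, $\mathrm{rad}(G)$ for the maximum and the minimum eccentricity of a vertex. The center $C(G)$ is the set $\{v : e_G(v)=\mathrm{rad}(G)\}$; we also write $C(G)$ for the subgraph of $G$ induced by this set. A graph $G$ is distance-hereditary if every connected induced subgraph $G'$ of $G$ is isometric, i.e. $d_{G'}(x,y)=d_G(x,y)$ for all vertices $x,y$ of $G'$. A cograph is a (not necessarily connected) graph that contains no path on four vertices as an induced subgraph. Theorem. (a) Let $G$ be a connected distance-hereditary graph, and let $H$ be the subgraph of $G$ induced by $C(G)$. Then either (i) $H$ is a cograph, or (ii) $H$ is a connected distance-hereditary graph with $\mathrm{diam}(H)=3$, and $C(H)$ is a connected cograph with $\mathrm{rad}(C(H))=2$ (the radius being computed in the graph $C(H)$ itself). (b) Conversely, for every graph $H$ that satisfies (i) or (ii) there is a connected distance-hereditary graph $G$ such that the subgraph of $G$ induced by $C(G)$ is isomorphic to $H$. -/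

import Mathlib

namespace SimpleGraph

/-- A graph is distance-hereditary if each of its connected induced subgraphs is isometric. -/
def IsDistanceHereditary {V : Type*} (G : SimpleGraph V) : Prop :=
  ∀ S : Set V, (G.induce S).Connected →
    ∀ x y : S, (G.induce S).dist x y = G.dist (x : V) (y : V)

/-- A cograph is a graph without an induced path on four vertices. -/
def IsCograph {V : Type*} (G : SimpleGraph V) : Prop :=
  ¬ (pathGraph 4).IsIndContained G

/-- The subgraph of `G` induced by its center (the vertices of minimum eccentricity). -/
abbrev centerGraph {V : Type*} (G : SimpleGraph V) : SimpleGraph G.center :=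
  G.induce G.center

/-- Connected distance-hereditary graphs of diameter three whose own center induces a connected
cograph of radius two. The radius is the one of the induced subgraph itself. -/
structure IsDiamThreeKind {V : Type*} (H : SimpleGraph V) : Prop where
  connected : H.Connected
  distanceHereditary : H.IsDistanceHereditary
  diam_eq : H.diam = 3
  center_connected : H.centerGraph.Connected
  center_cograph : H.centerGraph.IsCograph
  center_radius : H.centerGraph.radius = 2

end SimpleGraph

universe u

/-! ### Cographs, radius and distance in natural-number terms -/

namespace SimpleGraph

variable {V : Type*} {G : SimpleGraph V}

/-! Layer a distance-hereditary graph by the distance to a vertex `w`. Vertices of one layer joined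
by a walk that never comes closer to `w` have the same neighbours one layer down
(`LevelConn.adj_iff_aux`). This yields the inequality `IsDistanceHereditary.dist_add_dist_le`.
Applied to central vertices, it shows that they are at distance at most three and that geodesics of
length three between them stay in the center.

If the center of `G` is not a cograph, an induced path on four vertices in it is a geodesic of
length three. The center is then connected, hence isometric in `G`, and has diameter three. In a
distance-hereditary graph of diameter three the center is a connected cograph whose vertices have
eccentricity two (`center_of_diam_three`). For the second center, radius at most two follows by
isometry. Radius at least two is the delicate point (`exists_not_adj`): two steps from a vertex `v`
of the second center towards a vertex farthest from `v` in `G` end in the second center again.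

For the converse, leaves are attached to adjust eccentricities: in case (ii) to every central vertex
of `H`; in case (i) `H` is first joined to two non-adjacent vertices, each of which receives a leaf.
-/

theorem isCograph_iff : G.IsCograph ↔ ∀ a b c d, G.Adj a b → G.Adj b c → G.Adj c d →
    ¬ G.Adj a c → ¬ G.Adj a d → ¬ G.Adj b d → False := by
  constructor
  · intro h a b c d hab hbc hcd hac had hbd
    have h1 := hab.ne
    have h2 := hbc.ne
    have h3 := hcd.ne
    have h4 : a ≠ c := by rintro rfl; exact had hcd
    have h5 : a ≠ d := by rintro rfl; exact hac hcd.symm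
    have h6 : b ≠ d := by rintro rfl; exact had hab
    refine h ⟨⟨⟨![a, b, c, d], ?_⟩, ?_⟩⟩
    · intro i j hij
      fin_cases i <;> fin_cases j <;> simp_all
    · intro i j
      change G.Adj (![a, b, c, d] i) (![a, b, c, d] j) ↔ _
      simp only [pathGraph_adj]
      fin_cases i <;> fin_cases j <;> simp_all [G.adj_comm]
  · rintro h ⟨f⟩
    refine h (f 0) (f 1) (f 2) (f 3) ?_ ?_ ?_ ?_ ?_ ?_ <;>
      simp [pathGraph_adj]

/-- Replaces extended-natural eccentricities by plain distances: `h1` bounds every eccentricity from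
below by `r`, and `h2` says that `r` is attained. -/
theorem radius_eq_and_mem_center_iff [Finite V] (hG : G.Connected) {r : ℕ}
    (h1 : ∀ v, ∃ w, r ≤ G.dist v w) (h2 : ∃ v, ∀ w, G.dist v w ≤ r) :
    G.radius = r ∧ ∀ v, v ∈ G.center ↔ ∀ w, G.dist v w ≤ r := by
  have key : ∀ v, G.eccent v ≤ r ↔ ∀ w, G.dist v w ≤ r := by
    intro v
    rw [eccent_le_iff]
    refine forall_congr' fun w => ?_
    rw [← (hG v w).coe_dist_eq_edist]
    exact_mod_cast Iff.rfl
  have low : ∀ v, (r : ℕ∞) ≤ G.eccent v := by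
    intro v
    obtain ⟨w, hw⟩ := h1 v
    refine le_trans ?_ (edist_le_eccent (v := w))
    rw [← (hG v w).coe_dist_eq_edist]
    exact_mod_cast hw
  have hr : G.radius = r := by
    obtain ⟨v, hv⟩ := h2
    exact le_antisymm (radius_le_eccent.trans ((key v).2 hv)) (le_iInf low)
  refine ⟨hr, fun v => ?_⟩
  rw [mem_center_iff, hr, ← key]
  exact ⟨fun h => h.le, fun h => le_antisymm h (low v)⟩

theorem exists_radius [Finite V] (hG : G.Connected) : ∃ r : ℕ, G.radius = r ∧
    (∀ v, ∃ w, r ≤ G.dist v w) ∧ (∃ v, ∀ w, G.dist v w ≤ r) := by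
  have := hG.nonempty
  have hne : G.radius ≠ ⊤ := radius_ne_top_iff.2 hG
  obtain ⟨r, hr⟩ := ENat.ne_top_iff_exists.1 hne
  refine ⟨r, hr.symm, fun v => ?_, ?_⟩
  · obtain ⟨w, hw⟩ := G.exists_edist_eq_eccent_of_finite v
    refine ⟨w, ?_⟩
    have : (r : ℕ∞) ≤ G.edist v w := by rw [hr, hw]; exact radius_le_eccent
    rw [← (hG v w).coe_dist_eq_edist] at this
    exact_mod_cast this
  · obtain ⟨v, hv⟩ := G.exists_eccent_eq_radius
    refine ⟨v, fun w => ?_⟩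
    have : G.edist v w ≤ (r : ℕ∞) := by rw [hr, ← hv]; exact edist_le_eccent
    rw [← (hG v w).coe_dist_eq_edist] at this
    exact_mod_cast this

theorem Connected.exists_adj_dist_eq (hG : G.Connected) {x y : V} {n : ℕ}
    (h : G.dist x y = n + 1) : ∃ a, G.Adj x a ∧ G.dist a y = n := by
  obtain ⟨p, hp⟩ := hG.exists_walk_length_eq_dist x y
  cases p with
  | nil => simp at h
  | cons ha q =>
    rename_i a
    refine ⟨a, ha, ?_⟩
    have h1 := G.dist_le q
    have h2 := hG.dist_triangle (u := x) (v := a) (w := y)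
    rw [dist_eq_one_iff_adj.2 ha] at h2
    simp at hp
    omega

theorem Connected.dist_le_of_adj (hG : G.Connected) {x y : V} (h : G.Adj x y) (z : V) :
    G.dist x z ≤ G.dist y z + 1 := by
  have h2 := hG.dist_triangle (u := x) (v := y) (w := z)
  rw [dist_eq_one_iff_adj.2 h] at h2
  omega

theorem Connected.dist_le_two (hG : G.Connected) {x y z : V} (h : G.Adj x y) (h' : G.Adj y z) :
    G.dist x z ≤ 2 := by
  have := hG.dist_le_of_adj h z
  rw [dist_eq_one_iff_adj.2 h'] at this
  omega

/-! ### Levels around a vertex and the basic inequality -/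

/-- `u` and `v` are joined by a walk that stays at distance at least `k` from `w`. -/
def LevelConn (G : SimpleGraph V) (w : V) (k : ℕ) (u v : V) : Prop :=
  ∃ q : G.Walk u v, ∀ z ∈ q.support, k ≤ G.dist z w

namespace LevelConn

variable {w u v z : V} {k : ℕ}

theorem refl (h : k ≤ G.dist u w) : G.LevelConn w k u u := ⟨.nil, by simpa using h⟩

theorem symm (h : G.LevelConn w k u v) : G.LevelConn w k v u := by
  obtain ⟨q, hq⟩ := h
  exact ⟨q.reverse, by simpa using hq⟩

theorem trans (h : G.LevelConn w k u v) (h' : G.LevelConn w k v z) : G.LevelConn w k u z := by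
  obtain ⟨q, hq⟩ := h
  obtain ⟨q', hq'⟩ := h'
  refine ⟨q.append q', fun t ht => ?_⟩
  rcases Walk.mem_support_append_iff _ _ |>.1 ht with h | h
  exacts [hq t h, hq' t h]

theorem left_le (h : G.LevelConn w k u v) : k ≤ G.dist u w := by
  obtain ⟨q, hq⟩ := h
  exact hq _ q.start_mem_support

theorem right_le (h : G.LevelConn w k u v) : k ≤ G.dist v w := h.symm.left_le

theorem step (h : G.LevelConn w k u v) (ha : G.Adj v z) (hz : k ≤ G.dist z w) :
    G.LevelConn w k u z :=
  h.trans ⟨ha.toWalk, by simpa using ⟨h.right_le, hz⟩⟩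

/-- In a distance-hereditary graph, two vertices of a level that are joined above that level have
the same neighbours one level below. -/
theorem adj_iff_aux (hG : G.Connected) (hD : G.IsDistanceHereditary) (h : G.LevelConn w k u v)
    {p : V} (hp : G.Adj u p) (hpk : G.dist p w + 1 = k) (hv : G.dist v w = k) : G.Adj v p := by
  obtain ⟨q, hq⟩ := h
  obtain ⟨g, hg⟩ := hG.exists_walk_length_eq_dist p w
  have hgs : ∀ z ∈ g.support, z = p ∨ G.dist z w + 1 < k := by
    intro z hz
    classical
    by_cases hzp : z = p
    · exact Or.inl hzp
    right
    have h1 : (g.takeUntil z hz).length + (g.dropUntil z hz).length = g.length := by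
      rw [← Walk.length_append, Walk.take_spec]
    have h2 := G.dist_le (g.dropUntil z hz)
    have h3 := G.dist_le (g.takeUntil z hz)
    have h4 := hG.pos_dist_of_ne (Ne.symm hzp)
    omega
  -- The subgraph induced on the support of this walk is isometric, so it contains a neighbour `s`
  -- of `v` at distance `k - 1` from `w`. Vertices of `q` are too far from `w`, and those of `g`
  -- after `p` too close, so `s = p`.
  let W := q.reverse.append (Walk.cons hp g)
  let S : Set V := {z | z ∈ W.support}
  have hS : (G.induce S).Connected := W.connected_induce_support
  have hvS : v ∈ S := W.start_mem_support
  have hwS : w ∈ S := W.end_mem_support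
  have hd := hD S hS ⟨v, hvS⟩ ⟨w, hwS⟩
  simp only [hv] at hd
  obtain ⟨n, rfl⟩ : ∃ n, k = n + 1 := ⟨_, hpk.symm⟩
  obtain ⟨⟨s, hs⟩, hsa, hsd⟩ := hS.exists_adj_dist_eq hd
  rw [hD S hS] at hsd
  simp only at hsd
  have hsa' : G.Adj v s := hsa
  have hs' : s ∈ W.support := hs
  simp only [W, Walk.mem_support_append_iff, Walk.support_reverse, List.mem_reverse,
    Walk.support_cons, List.mem_cons] at hs'
  rcases hs' with h | rfl | h
  · have := hq s h
    omega
  · have := hq s q.start_mem_support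
    omega
  · rcases hgs s h with rfl | h
    · exact hsa'
    · omega

theorem exists_adj (hG : G.Connected) (h : k ≤ G.dist v w) :
    ∃ v', G.LevelConn w k v v' ∧ G.dist v' w = k ∧ G.dist v v' + k = G.dist v w := by
  obtain ⟨n, hn⟩ := Nat.exists_eq_add_of_le h
  induction n generalizing v with
  | zero => exact ⟨v, refl h, by simpa using hn, by simp [hn]⟩
  | succ n ih =>
    obtain ⟨a, ha, hd⟩ := hG.exists_adj_dist_eq (n := k + n) (by omega : G.dist v w = _)
    obtain ⟨v', h1, h2, h3⟩ := ih (v := a) (by omega) hd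
    refine ⟨v', ?_, h2, ?_⟩
    · exact ((refl h).step ha (by omega)).trans h1
    · have := hG.dist_le_of_adj ha v'
      have := hG.dist_triangle (u := v) (v := v') (w := w)
      omega

/-- Says that `p` lies on a geodesic from `v` to `w`: a direct descent from `v` to level `k` ends at
a vertex that must also be adjacent to `p`. -/
theorem dist_eq (hG : G.Connected) (hD : G.IsDistanceHereditary) (h : G.LevelConn w k u v)
    {p : V} (hp : G.Adj u p) (hpk : G.dist p w + 1 = k) :
    G.dist v p + k = G.dist v w + 1 := by
  obtain ⟨v', h1, h2, h3⟩ := exists_adj hG h.right_le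
  have h4 := (h.trans h1).adj_iff_aux hG hD hp hpk h2
  have h5 := hG.dist_triangle (u := v) (v := v') (w := p)
  rw [dist_eq_one_iff_adj.2 h4] at h5
  have := hG.dist_triangle (u := v) (v := p) (w := w)
  omega

end LevelConn

/-- The vertex `z` moves along a geodesic towards `y`. A first step below level `k` would reach a
neighbour of `x`, contradicting that the new vertex is at distance at least two from `x`. So `y` is
joined to `x` above level `k`, and a neighbour of `x` closer to `w` lies on a geodesic from `y` to
`w`. -/
theorem IsDistanceHereditary.dist_add_dist_le_aux (hG : G.Connected)
    (hD : G.IsDistanceHereditary) {x y w z : V} {k : ℕ} (hx : G.dist x w = k)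
    (hz : G.LevelConn w k x z) (hxz : x ≠ z) (hd : G.dist x z + G.dist z y = G.dist x y) :
    k + G.dist x y ≤ 2 + G.dist y w := by
  obtain ⟨n, hn⟩ : ∃ n, G.dist z y = n := ⟨_, rfl⟩
  rcases Nat.eq_zero_or_pos k with rfl | hk
  · rw [hG.dist_eq_zero_iff] at hx
    subst hx
    rw [G.dist_comm (u := x)]
    omega
  induction n generalizing z with
  | zero =>
    rw [hG.dist_eq_zero_iff] at hn
    subst hn
    obtain ⟨p, hp, hpd⟩ := hG.exists_adj_dist_eq (n := k - 1) (by omega : G.dist x w = _)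
    have h1 := hz.dist_eq hG hD hp (by omega)
    have h2 := hG.dist_le_of_adj hp z
    rw [G.dist_comm (u := p)] at h2
    omega
  | succ n ih =>
    obtain ⟨z', ha, hd'⟩ := hG.exists_adj_dist_eq hn
    have h0 := hG.pos_dist_of_ne hxz
    have h1 : G.dist x z' = G.dist x z + 1 := by
      have := hG.dist_triangle (u := x) (v := z') (w := y)
      have := hG.dist_le_of_adj ha.symm x
      rw [G.dist_comm (u := z'), G.dist_comm (u := z)] at this
      omega
    by_cases hk' : k ≤ G.dist z' w
    · refine ih (hz.step ha hk') ?_ (by omega) hd'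
      rintro rfl
      simp at h1
    · exfalso
      have h2 := hG.dist_le_of_adj ha w
      have h3 := hz.right_le
      have h4 := hz.symm.adj_iff_aux hG hD ha (by omega) hx
      rw [dist_eq_one_iff_adj.2 h4] at h1
      omega

/-- If the second vertex of a geodesic from `x` to `y` is not closer to `w` than `x`, then `x` is
close to a geodesic from `y` to `w`. -/
theorem IsDistanceHereditary.dist_add_dist_le (hG : G.Connected)
    (hD : G.IsDistanceHereditary) {x y w a : V} (ha : G.Adj x a)
    (hd : G.dist a y + 1 = G.dist x y) (h : G.dist x w ≤ G.dist a w) :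
    G.dist x w + G.dist x y ≤ 2 + G.dist y w := by
  refine hD.dist_add_dist_le_aux hG (z := a) rfl ((LevelConn.refl le_rfl).step ha h) ha.ne ?_
  rw [dist_eq_one_iff_adj.2 ha]
  omega

/-! ### Geodesics of length three and graphs of diameter three -/

/-- `x, a, b, y` is a path between two vertices at distance three. -/
structure IsGeodesicThree (G : SimpleGraph V) (x a b y : V) : Prop where
  adj₁ : G.Adj x a
  adj₂ : G.Adj a b
  adj₃ : G.Adj b y
  dist_eq : G.dist x y = 3

namespace IsGeodesicThree

variable {x a b y : V}

theorem symm (h : G.IsGeodesicThree x a b y) : G.IsGeodesicThree y b a x :=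
  ⟨h.adj₃.symm, h.adj₂.symm, h.adj₁.symm, by rw [dist_comm, h.dist_eq]⟩

theorem dist_right (hG : G.Connected) (h : G.IsGeodesicThree x a b y) : G.dist a y = 2 := by
  have := hG.dist_le_two h.adj₂ h.adj₃
  have := hG.dist_le_of_adj h.adj₁ y
  have := h.dist_eq
  omega

theorem replace (h : G.IsGeodesicThree x a b y) {v : V} (h1 : G.Adj x v)
    (h2 : G.Adj v b) : G.IsGeodesicThree x v b y :=
  ⟨h1, h2, h.adj₃, h.dist_eq⟩

end IsGeodesicThree

theorem Connected.exists_isGeodesicThree (hG : G.Connected) {x y : V} (h : G.dist x y = 3) :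
    ∃ a b, G.IsGeodesicThree x a b y := by
  obtain ⟨a, ha, h1⟩ := hG.exists_adj_dist_eq h
  obtain ⟨b, hb, h2⟩ := hG.exists_adj_dist_eq h1
  exact ⟨a, b, ha, hb, dist_eq_one_iff_adj.1 h2, h⟩

/-- If `a` were at distance two from `d`, the adjacent vertices `a` and `b` would lie in the same
level around `d`, so `a` would inherit the neighbour `c` of `b`. -/
theorem IsDistanceHereditary.isGeodesicThree (hG : G.Connected) (hD : G.IsDistanceHereditary)
    {a b c d : V} (hab : G.Adj a b) (hbc : G.Adj b c) (hcd : G.Adj c d)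
    (hac : ¬ G.Adj a c) (had : ¬ G.Adj a d) (hbd : ¬ G.Adj b d) :
    G.IsGeodesicThree a b c d := by
  refine ⟨hab, hbc, hcd, ?_⟩
  have h1 := hG.dist_le_two hbc hcd
  have h2 := hG.dist_le_of_adj hab d
  have hb : G.dist b d ≠ 1 := fun h => hbd (dist_eq_one_iff_adj.1 h)
  have ha : G.dist a d ≠ 1 := fun h => had (dist_eq_one_iff_adj.1 h)
  have hb0 : G.dist b d ≠ 0 := fun h => by
    rw [hG.dist_eq_zero_iff] at h; subst h; exact had hab
  have ha0 : G.dist a d ≠ 0 := fun h => by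
    rw [hG.dist_eq_zero_iff] at h; subst h; exact hac hcd.symm
  have hc := dist_eq_one_iff_adj.2 hcd
  by_contra h
  have h3 : G.dist a d = 2 := by omega
  have h4 : G.LevelConn d 2 b a := (LevelConn.refl (by omega)).step hab.symm (by omega)
  exact hac (h4.adj_iff_aux hG hD hbc (by omega) h3)

/-- Unless `v` is adjacent to `x`, the basic inequality makes `a` strictly closer to `v` than `x`
is, hence within distance one; the same holds for `y` and `b`. In the first two cases `v` can
replace an inner vertex of the geodesic. -/
theorem IsDistanceHereditary.trichotomy (hG : G.Connected) (hD : G.IsDistanceHereditary)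
    {x a b y : V} (h : G.IsGeodesicThree x a b y) {v : V} (hx : G.dist v x ≤ 2)
    (hy : G.dist v y ≤ 2) :
    (G.Adj x v ∧ G.Adj v b) ∨ (G.Adj v y ∧ G.Adj a v) ∨ (G.Adj v a ∧ G.Adj v b) := by
  rw [dist_comm] at hx hy
  have e := h.dist_eq
  have e1 := h.dist_right hG
  have e2 := h.symm.dist_right hG
  have h1 := hD.dist_add_dist_le hG (w := v) h.adj₁ (by omega : G.dist a y + 1 = G.dist x y)
  have h2 := hD.dist_add_dist_le hG (w := v) h.symm.adj₁
    (by rw [h.symm.dist_eq]; omega : G.dist b x + 1 = G.dist y x)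
  rw [h.symm.dist_eq] at h2
  have h3 := hG.dist_triangle (u := x) (v := v) (w := y)
  rw [G.dist_comm (u := v)] at h3
  have pa : G.dist a v ≤ 1 → G.dist x v ≠ 1 → G.Adj a v := by
    intro h4 h5
    refine dist_eq_one_iff_adj.1 (le_antisymm h4 (hG.pos_dist_of_ne ?_))
    rintro rfl
    exact h5 (dist_eq_one_iff_adj.2 h.adj₁)
  have pb : G.dist b v ≤ 1 → G.dist y v ≠ 1 → G.Adj b v := by
    intro h4 h5
    refine dist_eq_one_iff_adj.1 (le_antisymm h4 (hG.pos_dist_of_ne ?_))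
    rintro rfl
    exact h5 (dist_eq_one_iff_adj.2 h.adj₃.symm)
  by_cases c1 : G.dist x v = 1
  · exact Or.inl ⟨dist_eq_one_iff_adj.1 c1, (pb (by omega) (by omega)).symm⟩
  by_cases c2 : G.dist y v = 1
  · exact Or.inr (Or.inl ⟨(dist_eq_one_iff_adj.1 c2).symm, pa (by omega) (by omega)⟩)
  · exact Or.inr (Or.inr ⟨(pa (by omega) c1).symm, (pb (by omega) c2).symm⟩)

/-- Among the common neighbours of `x` and `b`, take `c` with an inclusion-minimal set of vertices
at distance at least three. If `u` is in that set, a vertex `s` between `x` and `u` is again such a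
common neighbour. Its far set is contained in that of `c` but misses `u`, against minimality. -/
theorem IsDistanceHereditary.exists_geodesic_center_left [Finite V] (hG : G.Connected)
    (hD : G.IsDistanceHereditary) (h3 : ∀ u v, G.dist u v ≤ 3) {x a b y : V}
    (h : G.IsGeodesicThree x a b y) :
    ∃ a', G.IsGeodesicThree x a' b y ∧ ∀ u, G.dist a' u ≤ 2 := by
  let A : Set V := {c | G.Adj x c ∧ G.Adj c b}
  let F : V → Set V := fun c => {u | 3 ≤ G.dist c u}
  obtain ⟨c, ⟨hcx, hcb⟩, hmin⟩ := (Set.toFinite A).exists_minimalFor F A ⟨a, h.adj₁, h.adj₂⟩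
  have hc := h.replace hcx hcb
  refine ⟨c, hc, fun u => ?_⟩
  by_contra hu
  have far : ∀ c u, G.IsGeodesicThree x c b y → 3 ≤ G.dist c u →
      G.dist x u = 2 ∧ G.dist b u = 2 := by
    intro c u hc hu
    have e1 := hc.dist_right hG
    have e2 := hc.symm.dist_right hG
    have e := hc.dist_eq
    have e' := hc.symm.dist_eq
    have h1 := hD.dist_add_dist_le hG (w := u) hc.adj₁ (by omega : G.dist c y + 1 = G.dist x y)
    have h2 := hD.dist_add_dist_le hG (w := u) hc.symm.adj₁
      (by omega : G.dist b x + 1 = G.dist y x)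
    have := h3 x u
    have := h3 y u
    have := h3 b u
    have := hG.dist_le_of_adj hc.adj₁.symm u
    have := hG.dist_le_of_adj hc.adj₂ u
    omega
  obtain ⟨hxu, hbu⟩ := far c u hc (by omega)
  obtain ⟨s, hs, hsu⟩ := hG.exists_adj_dist_eq hxu
  have hsu' := dist_eq_one_iff_adj.1 hsu
  have hbs : G.Adj b s :=
    (((LevelConn.refl hxu.ge).step hcx (by omega)).step hcb hbu.ge).adj_iff_aux hG hD hs
      (by omega) hbu
  have hsg := h.replace hs hbs.symm
  have hle : F s ≤ F c := by
    intro t ht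
    by_contra htc
    simp only [F, Set.mem_ofPred_eq] at ht htc
    have huc : G.dist u c = 3 := by
      have := h3 u c
      rw [dist_comm] at this ⊢
      omega
    have hsc : G.dist s c ≤ 2 := hG.dist_le_two hs.symm hcx
    have hsc' := hG.dist_le_of_adj hsu'.symm c
    have h4 := hD.dist_add_dist_le hG (w := t) hsu'.symm (by omega : G.dist s c + 1 = G.dist u c)
      ((h3 u t).trans ht)
    have := hG.dist_le_of_adj hsu' t
    omega
  have : u ∈ F s := hmin ⟨hs, hbs.symm⟩ hle (show 3 ≤ G.dist c u by omega)
  simp only [F, Set.mem_ofPred_eq] at this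
  omega

theorem IsDistanceHereditary.exists_geodesic_center [Finite V] (hG : G.Connected)
    (hD : G.IsDistanceHereditary) (h3 : ∀ u v, G.dist u v ≤ 3) {x y : V} (h : G.dist x y = 3) :
    ∃ a b, G.IsGeodesicThree x a b y ∧ (∀ u, G.dist a u ≤ 2) ∧ ∀ u, G.dist b u ≤ 2 := by
  obtain ⟨a, b, hab⟩ := hG.exists_isGeodesicThree h
  obtain ⟨a', ha, ha'⟩ := hD.exists_geodesic_center_left hG h3 hab
  obtain ⟨b', hb, hb'⟩ := hD.exists_geodesic_center_left hG h3 ha.symm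
  exact ⟨a', b', hb.symm, ha', hb'⟩

theorem IsDistanceHereditary.center_of_diam_three [Finite V] (hG : G.Connected)
    (hD : G.IsDistanceHereditary) (h3 : ∀ u v, G.dist u v ≤ 3) {x y : V} (h : G.dist x y = 3) :
    (∀ v, v ∈ G.center ↔ ∀ u, G.dist v u ≤ 2) ∧ G.centerGraph.Connected ∧
      G.centerGraph.IsCograph := by
  obtain ⟨a, b, hab, ha, hb⟩ := hD.exists_geodesic_center hG h3 h
  have hc := (radius_eq_and_mem_center_iff hG (r := 2) (fun v => by
    by_contra hv
    push Not at hv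
    have h1 := hv x
    have h2 := hv y
    have := hG.dist_triangle (u := x) (v := v) (w := y)
    rw [G.dist_comm (u := x) (v := v)] at this
    omega) ⟨a, ha⟩).2
  refine ⟨hc, ?_, ?_⟩
  · have haC := (hc a).2 ha
    have hbC := (hc b).2 hb
    rw [connected_iff_exists_forall_reachable]
    refine ⟨⟨a, haC⟩, fun ⟨v, hvC⟩ => ?_⟩
    have hv := (hc v).1 hvC
    have h1 : G.centerGraph.Reachable ⟨a, haC⟩ ⟨b, hbC⟩ := Adj.reachable (by exact hab.adj₂)
    rcases hD.trichotomy hG hab (hv x) (hv y) with h | h | h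
    · exact h1.trans (Adj.reachable (by exact h.2.symm))
    · exact Adj.reachable (by exact h.2)
    · exact Adj.reachable (by exact h.1.symm)
  · rw [isCograph_iff]
    intro p q s t h1 h2 h3 h4 h5 h6
    have := (hD.isGeodesicThree hG (a := p) (b := q) (c := s) (d := t) h1 h2 h3 h4 h5 h6).dist_eq
    have := (hc p).1 p.2 t
    omega

/-! ### Central vertices at distance three -/

section Center

variable {r : ℕ}

/-- The basic inequality bounds `G.dist x w + G.dist x y` by `r + 2`, while `G.dist x w` is at least
`r - 1`; with `G.dist x y` at least three, every estimate is tight. -/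
theorem IsDistanceHereditary.geodesic_dist (hG : G.Connected) (hD : G.IsDistanceHereditary)
    {x y a w : V} (hx : ∀ w, G.dist x w ≤ r) (hy : ∀ w, G.dist y w ≤ r) (ha : G.Adj x a)
    (had : G.dist a y + 1 = G.dist x y) (h3 : 3 ≤ G.dist x y) (hw : r ≤ G.dist a w) :
    G.dist x y = 3 ∧ G.dist a w = r ∧ G.dist x w + 1 = r ∧ G.dist y w = r := by
  have h1 := hx w
  have h2 := hy w
  have h4 := hD.dist_add_dist_le hG (w := w) ha had (by omega)
  have := hG.dist_le_of_adj ha.symm w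
  omega

theorem IsDistanceHereditary.forall_dist_le_of_geodesic (hG : G.Connected)
    (hD : G.IsDistanceHereditary) {x y a : V} (hx : ∀ w, G.dist x w ≤ r)
    (hy : ∀ w, G.dist y w ≤ r) (ha : G.Adj x a) (had : G.dist a y + 1 = G.dist x y)
    (h3 : 3 ≤ G.dist x y) (w : V) : G.dist a w ≤ r := by
  by_contra hw
  have := hD.geodesic_dist hG hx hy ha had h3 (w := w) (by omega)
  omega

theorem IsDistanceHereditary.dist_le_three (hG : G.Connected) (hD : G.IsDistanceHereditary)
    (hr : ∀ v, ∃ w, r ≤ G.dist v w)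
    {x y : V} (hx : ∀ w, G.dist x w ≤ r) (hy : ∀ w, G.dist y w ≤ r) : G.dist x y ≤ 3 := by
  by_contra h
  obtain ⟨n, hn⟩ : ∃ n, G.dist x y = n + 1 := ⟨G.dist x y - 1, by omega⟩
  obtain ⟨a, ha, hd⟩ := hG.exists_adj_dist_eq hn
  obtain ⟨w, hw⟩ := hr a
  have := hD.geodesic_dist hG hx hy ha (by omega) (by omega) hw
  omega

/-- Vertices at level `k` in the component of `p` are adjacent to `c`. If `a` and `b` are both
there, a vertex too far from `c` would force two different distances from `x`. Otherwise one of them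
is at level `k + 1`, its outer neighbour on the geodesic is at level `k`, and `c` replaces it as an
inner vertex of a geodesic between `x` and `y`. -/
theorem IsDistanceHereditary.forall_dist_le_of_levelConn (hG : G.Connected)
    (hD : G.IsDistanceHereditary) {x a b y p c w : V} {k : ℕ}
    (hx : ∀ w, G.dist x w ≤ k + 1) (hy : ∀ w, G.dist y w ≤ k + 1)
    (h : G.IsGeodesicThree x a b y) (ha : G.LevelConn w k p a) (hb : G.LevelConn w k p b)
    (hpc : G.Adj p c) (hc : G.dist c w + 1 = k) (t : V) : G.dist c t ≤ k + 1 := by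
  have e := h.dist_eq
  have e' := h.symm.dist_eq
  have ea := h.dist_right hG
  have eb := h.symm.dist_right hG
  have maxa : ∀ t, k + 1 ≤ G.dist a t → _ := fun t =>
    hD.geodesic_dist hG (w := t) hx hy h.adj₁ (by omega) (by omega)
  have maxb : ∀ t, k + 1 ≤ G.dist b t → _ := fun t =>
    hD.geodesic_dist hG (w := t) hy hx h.symm.adj₁ (by omega) (by omega)
  have la := ha.right_le
  have lb := hb.right_le
  have ra := hD.forall_dist_le_of_geodesic hG hx hy h.adj₁ (by omega) (by omega)
  have rb := hD.forall_dist_le_of_geodesic hG hy hx h.symm.adj₁ (by omega) (by omega)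
  have adj : ∀ {z}, G.LevelConn w k p z → G.dist z w = k → G.Adj z c := fun hz hzk =>
    hz.adj_iff_aux hG hD hpc hc hzk
  by_cases ca : G.dist a w = k
  · by_cases cb : G.dist b w = k
    · have h1 := adj ha ca
      have h2 := adj hb cb
      by_contra ht
      have h3 := hG.dist_le_of_adj h1.symm t
      have h4 := hG.dist_le_of_adj h2.symm t
      have := maxa t (by omega)
      have := maxb t (by omega)
      omega
    · have hw := maxb w (by omega)
      have h1 := adj (hb.step h.adj₃ (by omega)) (by omega)
      have h2 := adj ha ca
      have h3 := hG.dist_le_two h2.symm h.adj₁.symm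
      have h4 := hG.dist_le_of_adj h1 x
      exact hD.forall_dist_le_of_geodesic hG hy hx h1 (by omega) (by omega) t
  · have hw := maxa w (by omega)
    have cb : G.dist b w = k := by
      by_contra cb
      have := maxb w (by omega)
      omega
    have h1 := adj (ha.step h.adj₁.symm (by omega)) (by omega)
    have h2 := adj hb cb
    have h3 := hG.dist_le_two h2.symm h.adj₃
    have h4 := hG.dist_le_of_adj h1 y
    exact hD.forall_dist_le_of_geodesic hG hx hy h1 (by omega) (by omega) t

/-- The witness `c` is two steps from `v` on a geodesic to a farthest vertex `w`. A central `u`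
joined to `v` above level `r - 1` is within two of `c` because `c` lies on a geodesic from `u` to
`w`. Any other central `u` is at distance two from `v`, and the level property makes it adjacent to
`p`, the vertex between `v` and `c`. -/
theorem IsDistanceHereditary.exists_not_adj (hG : G.Connected)
    (hD : G.IsDistanceHereditary) (hr : ∀ v, ∃ w, r ≤ G.dist v w)
    {x a b y v : V} (hx : ∀ w, G.dist x w ≤ r) (hy : ∀ w, G.dist y w ≤ r)
    (h : G.IsGeodesicThree x a b y) (hv : ∀ w, G.dist v w ≤ r)
    (hv2 : ∀ u, (∀ w, G.dist u w ≤ r) → G.dist v u ≤ 2) :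
    ∃ c, (∀ w, G.dist c w ≤ r) ∧ (∀ u, (∀ w, G.dist u w ≤ r) → G.dist c u ≤ 2) ∧
      2 ≤ G.dist v c := by
  have e := h.dist_eq
  have e' := h.symm.dist_eq
  have ea := h.dist_right hG
  have eb := h.symm.dist_right hG
  have r3 : 3 ≤ r := e ▸ hx y
  obtain ⟨j, rfl⟩ : ∃ j, r = j + 2 := ⟨r - 2, by omega⟩
  have ra := hD.forall_dist_le_of_geodesic hG hx hy h.adj₁ (by omega) (by omega)
  have rb := hD.forall_dist_le_of_geodesic hG hy hx h.symm.adj₁ (by omega) (by omega)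
  obtain ⟨w, hw⟩ := hr v
  obtain ⟨p, hvp, hpw⟩ := hG.exists_adj_dist_eq (n := j + 1) (le_antisymm (hv w) hw)
  obtain ⟨c, hpc, hcw⟩ := hG.exists_adj_dist_eq hpw
  have hvK : G.LevelConn w (j + 1) p v := (LevelConn.refl hpw.ge).step hvp.symm (by omega)
  have near : ∀ {z}, G.Adj v z → G.LevelConn w (j + 1) p z := by
    intro z hz
    refine hvK.step hz ?_
    have := hG.dist_le_of_adj hz w
    omega
  have hcC : ∀ t, G.dist c t ≤ j + 2 := by
    -- All neighbours of `v` are at level at least `j + 1`, so in each case the inner vertices of a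
    -- suitable geodesic lie in the component of `p`.
    rcases hD.trichotomy hG h (hv2 x hx) (hv2 y hy) with ⟨h1, h2⟩ | ⟨h1, h2⟩ | ⟨h1, h2⟩
    · exact hD.forall_dist_le_of_levelConn hG hx hy (h.replace h1 h2) hvK (near h2) hpc
        (by omega)
    · exact hD.forall_dist_le_of_levelConn hG hx hy (h.symm.replace h1.symm h2.symm).symm
        (near h2.symm) hvK hpc (by omega)
    · exact hD.forall_dist_le_of_levelConn hG hx hy h (near h1) (near h2) hpc (by omega)
  refine ⟨c, hcC, fun u hu => ?_, ?_⟩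
  · have hK : ∀ z, (∀ w, G.dist z w ≤ j + 2) → G.LevelConn w (j + 1) p z → G.dist c z ≤ 2 := by
      intro z hz hzK
      have := hzK.dist_eq hG hD hpc (by omega)
      have := hz w
      rw [dist_comm]
      omega
    by_cases huK : G.LevelConn w (j + 1) p u
    · exact hK u hu huK
    have h2 := hv2 u hu
    have h0 : G.dist v u ≠ 0 := by
      intro h0
      rw [hG.dist_eq_zero_iff] at h0
      exact huK (h0 ▸ hvK)
    have h1 : G.dist v u ≠ 1 := fun h1 => huK (near (dist_eq_one_iff_adj.1 h1))
    obtain ⟨s, hs, hsu⟩ := hG.exists_adj_dist_eq (by omega : G.dist v u = 1 + 1)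
    have hsu := dist_eq_one_iff_adj.1 hsu
    have hsK := near hs
    have hlow : G.dist u w < j + 1 := by
      by_contra hlow
      exact huK (hsK.step hsu (by omega))
    have := hsK.right_le
    have := hG.dist_le_of_adj hsu w
    have hpu : G.Adj p u := hsK.symm.adj_iff_aux hG hD hsu (by omega) hpw
    exact hG.dist_le_two hpc.symm hpu
  · have := hG.dist_triangle (u := v) (v := c) (w := w)
    omega

end Center

/-! ### Structure of a center that is not a cograph -/

theorem Hom.dist_map_le {W : Type*} {G' : SimpleGraph W} (f : G →g G') {u v : V}
    (h : G.Reachable u v) : G'.dist (f u) (f v) ≤ G.dist u v := by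
  obtain ⟨q, hq⟩ := h.exists_walk_length_eq_dist
  rw [← hq, ← Walk.length_map f q]
  exact dist_le _

theorem IsDistanceHereditary.induce (hD : G.IsDistanceHereditary) {C : Set V}
    (hC : (G.induce C).Connected) : (G.induce C).IsDistanceHereditary := by
  intro S hS x y
  rw [hD C hC]
  let e : (G.induce C).induce S ≃g G.induce (Subtype.val '' S : Set V) :=
    { toFun := fun z => ⟨z.1.1, z.1, z.2, rfl⟩
      invFun := fun z => ⟨⟨z.1, by obtain ⟨t, -, h⟩ := z.2; exact h ▸ t.2⟩, by
        obtain ⟨t, ht, h⟩ := z.2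
        have : t = ⟨z.1, h ▸ t.2⟩ := Subtype.ext h
        exact this ▸ ht⟩
      left_inv := fun z => rfl
      right_inv := fun z => rfl
      map_rel_iff' := Iff.rfl }
  have hS' : (G.induce (Subtype.val '' S : Set V)).Connected := e.connected_iff.1 hS
  have h := hD _ hS' (e x) (e y)
  change _ = G.dist x.1.1 y.1.1 at h
  rw [← h]
  have h1 := Hom.dist_map_le e.toHom (hS x y)
  have h2 := Hom.dist_map_le e.symm.toHom (hS' (e x) (e y))
  change _ ≤ ((G.induce (Subtype.val '' S : Set V)).dist (e x) (e y)) at h2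
  exact le_antisymm h2 h1

/-- Central vertices at distance one or three are joined inside the center, so only distance two
could obstruct. The basic inequality forbids that a vertex be at distance two from all of `x`, `y`
and `a`. -/
theorem IsDistanceHereditary.centerGraph_connected (hG : G.Connected)
    (hD : G.IsDistanceHereditary) {r : ℕ} (hr : ∀ v, ∃ w, r ≤ G.dist v w)
    (hC : ∀ v, v ∈ G.center ↔ ∀ w, G.dist v w ≤ r) {x a b y : V} (hx : x ∈ G.center)
    (hy : y ∈ G.center) (h : G.IsGeodesicThree x a b y) : G.centerGraph.Connected := by
  have mem : ∀ {x a b y}, x ∈ G.center → y ∈ G.center → G.IsGeodesicThree x a b y →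
      a ∈ G.center := by
    intro x a b y hx hy h
    have := h.dist_right hG
    have := h.dist_eq
    rw [hC] at *
    exact hD.forall_dist_le_of_geodesic hG hx hy h.adj₁ (by omega) (by omega)
  have reach : ∀ {u v} (hu : u ∈ G.center) (hv : v ∈ G.center), G.dist u v ≠ 2 →
      G.centerGraph.Reachable ⟨u, hu⟩ ⟨v, hv⟩ := by
    intro u v hu hv h2
    have h3 := hD.dist_le_three hG hr ((hC u).1 hu) ((hC v).1 hv)
    obtain h0 | h1 | h3 : G.dist u v = 0 ∨ G.dist u v = 1 ∨ G.dist u v = 3 := by omega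
    · rw [hG.dist_eq_zero_iff] at h0
      subst h0
      exact Reachable.refl _
    · have := dist_eq_one_iff_adj.1 h1
      exact Adj.reachable (by exact this)
    · obtain ⟨a, b, hab⟩ := hG.exists_isGeodesicThree h3
      have ha := mem hu hv hab
      have hb := mem hv hu hab.symm
      have r1 : G.centerGraph.Reachable ⟨u, hu⟩ ⟨a, ha⟩ := Adj.reachable (by exact hab.adj₁)
      have r2 : G.centerGraph.Reachable ⟨a, ha⟩ ⟨b, hb⟩ := Adj.reachable (by exact hab.adj₂)
      have r3 : G.centerGraph.Reachable ⟨b, hb⟩ ⟨v, hv⟩ := Adj.reachable (by exact hab.adj₃)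
      exact (r1.trans r2).trans r3
  have e := h.dist_eq
  have ha := mem hx hy h
  rw [connected_iff_exists_forall_reachable]
  refine ⟨⟨x, hx⟩, fun ⟨v, hv⟩ => ?_⟩
  by_cases c1 : G.dist x v = 2
  · by_cases c2 : G.dist y v = 2
    · by_cases c3 : G.dist a v = 2
      · have := h.dist_right hG
        have := hD.dist_add_dist_le hG (w := v) h.adj₁ (by omega : G.dist a y + 1 = G.dist x y)
        omega
      · exact (reach hx ha (by rw [dist_eq_one_iff_adj.2 h.adj₁]; omega)).trans (reach ha hv c3)
    · exact (reach hx hy (by omega)).trans (reach hy hv c2)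
  · exact reach hx hv c1

theorem IsDistanceHereditary.centerGraph_isDiamThreeKind [Finite V] (hG : G.Connected)
    (hD : G.IsDistanceHereditary) (hco : ¬ G.centerGraph.IsCograph) :
    G.centerGraph.IsDiamThreeKind := by
  obtain ⟨r, -, hr, hr'⟩ := exists_radius hG
  have hC := (radius_eq_and_mem_center_iff hG hr hr').2
  obtain ⟨x, y, hx, hy, a, b, h⟩ :
      ∃ x y, x ∈ G.center ∧ y ∈ G.center ∧ ∃ a b, G.IsGeodesicThree x a b y := by
    rw [isCograph_iff] at hco
    push Not at hco
    obtain ⟨p, q, s, t, h1, h2, h3, h4, h5, h6, -⟩ := hco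
    exact ⟨p, t, p.2, t.2, q, s, hD.isGeodesicThree hG h1 h2 h3 h4 h5 h6⟩
  have hH := hD.centerGraph_connected hG hr hC hx hy h
  have hHD := hD.induce hH
  have hd : ∀ u v : G.center, G.centerGraph.dist u v = G.dist (u : V) v := hD _ hH
  have h3 : ∀ u v, G.centerGraph.dist u v ≤ 3 := fun u v => by
    rw [hd]
    exact hD.dist_le_three hG hr ((hC u).1 u.2) ((hC v).1 v.2)
  have hxy : G.centerGraph.dist ⟨x, hx⟩ ⟨y, hy⟩ = 3 := by rw [hd, h.dist_eq]
  obtain ⟨hCC, hconn, hcog⟩ := hHD.center_of_diam_three hH h3 hxy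
  have hdd : ∀ u v : G.centerGraph.center, G.centerGraph.centerGraph.dist u v =
      G.centerGraph.dist (u : G.center) v := hHD _ hconn
  refine ⟨hH, hHD, ?_, hconn, hcog, ?_⟩
  · have := hH.nonempty
    apply le_antisymm
    · obtain ⟨u, v, huv⟩ := G.centerGraph.exists_dist_eq_diam
      rw [← huv]
      exact h3 u v
    · rw [← hxy]
      exact dist_le_diam (connected_iff_ediam_ne_top.1 hH)
  · refine (radius_eq_and_mem_center_iff hconn (r := 2) ?_ ?_).1
    · rintro ⟨v, hv⟩
      have hv' := (hCC v).1 hv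
      obtain ⟨c, hc1, hc2, hc3⟩ := hD.exists_not_adj hG hr ((hC x).1 hx) ((hC y).1 hy) h
        ((hC v).1 v.2) (fun u hu => by
          have := hv' ⟨u, (hC u).2 hu⟩
          rwa [hd] at this)
      refine ⟨⟨⟨c, (hC c).2 hc1⟩, (hCC _).2 fun u => ?_⟩, ?_⟩
      · rw [hd]
        exact hc2 u ((hC u).1 u.2)
      · rw [hdd, hd]
        exact hc3
    · have := hconn.nonempty
      obtain ⟨v⟩ := this
      refine ⟨v, fun w => ?_⟩
      rw [hdd]
      exact (hCC v).1 v.2 w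

end SimpleGraph

/-! ### The converse: attaching leaves -/

namespace SimpleGraph

/-- The graph obtained from `H` by attaching a pendant vertex to each vertex of `S`. -/
def pendant {W : Type*} (H : SimpleGraph W) (S : Set W) : SimpleGraph (W ⊕ S) where
  Adj
    | .inl a, .inl b => H.Adj a b
    | .inl a, .inr s => a = s
    | .inr s, .inl a => a = s
    | .inr _, .inr _ => False
  symm := ⟨by
    rintro (a | s) (b | t) h
    exacts [H.adj_symm h, h, h, h]⟩
  loopless := ⟨by
    rintro (a | s) h
    exacts [H.irrefl h, h]⟩

namespace pendant

variable {W : Type*} {H : SimpleGraph W} {S : Set W}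

/-- The vertex to which a vertex is attached. -/
def base : W ⊕ S → W := Sum.elim id Subtype.val

/-- The distance of a vertex to its base. -/
def height : W ⊕ S → ℕ := Sum.elim 0 1

theorem dist_base_le_length (hH : H.Connected) {u v : W ⊕ S} (q : (H.pendant S).Walk u v)
    (huv : u ≠ v) : H.dist (base u) (base v) + height u + height v ≤ q.length := by
  induction q with
  | nil => exact absurd rfl huv
  | @cons u u' v ha q ih =>
    rw [Walk.length_cons]
    by_cases h : u' = v
    · subst h
      rcases u with a | s <;> rcases u' with b | t
      · have : H.Adj a b := ha
        simp [base, height, dist_eq_one_iff_adj.2 this]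
      · have : a = t := ha
        simp [base, height, this]
      · have : b = s := ha
        simp [base, height, this]
      · exact ha.elim
    · have := ih h
      rcases u with a | s <;> rcases u' with b | t
      · have h1 : H.Adj a b := ha
        have := hH.dist_le_of_adj h1 (base v)
        simp only [base, height, Sum.elim_inl, id, Pi.zero_apply] at *
        omega
      · have h1 : a = t := ha
        simp only [base, height, Sum.elim_inl, Sum.elim_inr, id, Pi.zero_apply, Pi.one_apply,
          h1] at *
        omega
      · have h1 : b = s := ha
        simp only [base, height, Sum.elim_inl, Sum.elim_inr, id, Pi.zero_apply, Pi.one_apply,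
          h1] at *
        omega
      · exact ha.elim

theorem dist_le_of_induce (hD : H.IsDistanceHereditary) {T : Set (W ⊕ S)}
    (hT : ((H.pendant S).induce T).Connected) {x y : T} (hxy : x ≠ y) :
    ((H.pendant S).induce T).dist x y
      ≤ H.dist (base x.1) (base y.1) + height x.1 + height y.1 := by
  -- A connected set with two vertices contains the base of each of its leaves, since a leaf has no
  -- other neighbour.
  have hbase : ∀ z : T, (Sum.inl (base z.1) : W ⊕ S) ∈ T := by
    intro z
    obtain ⟨z', hz'⟩ : ∃ z' : T, z ≠ z' := by
      by_cases h : z = x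
      · exact ⟨y, h ▸ hxy⟩
      · exact ⟨x, h⟩
    have h0 := hT.pos_dist_of_ne hz'
    obtain ⟨n, hn⟩ := Nat.exists_eq_add_of_lt h0
    obtain ⟨a, ha, -⟩ := hT.exists_adj_dist_eq hn
    rcases z with ⟨w | s, hz⟩
    · exact hz
    · rcases a with ⟨b | t, hb⟩
      · have h1 : b = s := ha
        exact (show base (Sum.inr s : W ⊕ S) = b from h1.symm) ▸ hb
      · exact (show False from ha).elim
  let T₀ : Set W := {a | (Sum.inl a : W ⊕ S) ∈ T}
  have hreach : ∀ {u v : T}, ((H.pendant S).induce T).Walk u v →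
      (H.induce T₀).Reachable ⟨base u.1, hbase u⟩ ⟨base v.1, hbase v⟩ := by
    intro u v q
    induction q with
    | nil => exact Reachable.refl _
    | @cons u u' v ha q ih =>
      refine Reachable.trans ?_ ih
      have ha' : (H.pendant S).Adj u.1 u'.1 := ha
      rcases u with ⟨a | s, hu⟩ <;> rcases u' with ⟨b | t, hu'⟩
      · exact Adj.reachable (show H.Adj a b from ha')
      · have h1 : a = t := ha'
        simp [base, h1]
      · have h1 : b = s := ha'
        simp [base, h1]
      · exact ha'.elim
  have hT₀ : (H.induce T₀).Connected := by
    rw [connected_iff_exists_forall_reachable]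
    refine ⟨⟨base x.1, hbase x⟩, fun ⟨a, ha⟩ => ?_⟩
    obtain ⟨q⟩ := hT x ⟨Sum.inl a, ha⟩
    exact hreach q
  let f : H.induce T₀ →g (H.pendant S).induce T := ⟨fun a => ⟨Sum.inl a.1, a.2⟩, fun h => h⟩
  have h1 := Hom.dist_map_le f (hT₀ ⟨base x.1, hbase x⟩ ⟨base y.1, hbase y⟩)
  rw [hD T₀ hT₀] at h1
  have hh : ∀ z : T, ((H.pendant S).induce T).dist z ⟨Sum.inl (base z.1), hbase z⟩
      ≤ height z.1 := by
    rintro ⟨w | s, hz⟩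
    · exact (dist_self (G := (H.pendant S).induce T)).le
    · have : ((H.pendant S).induce T).Adj ⟨Sum.inr s, hz⟩ ⟨Sum.inl s, hbase ⟨_, hz⟩⟩ :=
        rfl
      exact (dist_eq_one_iff_adj.2 this).le
  have h2 := hh x
  have h3 := hh y
  rw [dist_comm] at h3
  have h4 := hT.dist_triangle (u := x) (v := ⟨Sum.inl (base x.1), hbase x⟩) (w := y)
  have h5 := hT.dist_triangle (u := ⟨Sum.inl (base x.1), hbase x⟩)
    (v := ⟨Sum.inl (base y.1), hbase y⟩) (w := y)
  have h6 : ((H.pendant S).induce T).dist ⟨Sum.inl (base x.1), hbase x⟩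
    ⟨Sum.inl (base y.1), hbase y⟩ ≤ H.dist (base x.1) (base y.1) := h1
  omega

theorem connected (hH : H.Connected) : (H.pendant S).Connected := by
  obtain ⟨w⟩ := hH.nonempty
  rw [connected_iff_exists_forall_reachable]
  let f : H →g H.pendant S := ⟨Sum.inl, fun h => h⟩
  refine ⟨Sum.inl w, ?_⟩
  rintro (a | s)
  · exact (hH w a).map f
  · exact ((hH w s).map f).trans (Adj.reachable (show (H.pendant S).Adj _ _ from rfl))

theorem isDistanceHereditary (hH : H.Connected) (hD : H.IsDistanceHereditary) :
    (H.pendant S).IsDistanceHereditary := by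
  intro T hT x y
  by_cases hxy : x = y
  · subst hxy
    simp
  · apply le_antisymm
    · refine (dist_le_of_induce hD hT hxy).trans ?_
      obtain ⟨q, hq⟩ := (connected (S := S) hH).exists_walk_length_eq_dist x.1 y.1
      rw [← hq]
      exact dist_base_le_length hH q (fun h => hxy (Subtype.ext h))
    · exact Hom.dist_map_le (Embedding.induce T).toHom (hT x y)

theorem dist_eq (hH : H.Connected) (hD : H.IsDistanceHereditary) {u v : W ⊕ S} (huv : u ≠ v) :
    (H.pendant S).dist u v = H.dist (base u) (base v) + height u + height v := by
  have hc := connected (S := S) hH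
  apply le_antisymm
  · have hT : ((H.pendant S).induce Set.univ).Connected :=
      (induceUnivIso (H.pendant S)).connected_iff.2 hc
    have h1 := dist_le_of_induce hD hT (x := ⟨u, trivial⟩) (y := ⟨v, trivial⟩)
      (fun h => huv (congrArg Subtype.val h))
    rwa [isDistanceHereditary hH hD _ hT] at h1
  · obtain ⟨q, hq⟩ := hc.exists_walk_length_eq_dist u v
    rw [← hq]
    exact dist_base_le_length hH q huv

end pendant

theorem nonempty_centerGraph_iso {V W : Type*} {G : SimpleGraph V} {H : SimpleGraph W}
    (f : H ↪g G) (hf : ∀ v, v ∈ G.center ↔ v ∈ Set.range f) : Nonempty (G.centerGraph ≃g H) := by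
  let e : W ≃ G.center := Equiv.ofBijective (fun w => ⟨f w, (hf _).2 ⟨w, rfl⟩⟩) <| by
    refine ⟨fun a b h => f.injective (congrArg Subtype.val h), fun ⟨v, hv⟩ => ?_⟩
    obtain ⟨w, rfl⟩ := (hf v).1 hv
    exact ⟨w, rfl⟩
  have e' : H ≃g G.centerGraph := ⟨e, f.map_rel_iff⟩
  exact ⟨e'.symm⟩

/-- Vertices of `H` get eccentricity three: non-central ones already have it in `H`, and central
ones reach it at the leaf of a central vertex two away. Leaves have eccentricity at least four. -/
theorem IsDiamThreeKind.exists_centerGraph_iso {W : Type*} [Finite W] {H : SimpleGraph W}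
    (h : H.IsDiamThreeKind) : (H.pendant H.center).Connected ∧
      (H.pendant H.center).IsDistanceHereditary ∧
      Nonempty ((H.pendant H.center).centerGraph ≃g H) := by
  have hH := h.connected
  have hD := h.distanceHereditary
  have hdist {u v} (huv : u ≠ v) := pendant.dist_eq (S := H.center) hH hD huv
  have hc := pendant.connected (S := H.center) hH
  refine ⟨hc, pendant.isDistanceHereditary hH hD, ?_⟩
  have := hH.nonempty
  have h3 : ∀ a b, H.dist a b ≤ 3 := fun a b =>
    h.diam_eq ▸ dist_le_diam (connected_iff_ediam_ne_top.1 hH)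
  have hcd : ∀ a b : H.center, H.centerGraph.dist a b = H.dist (a : W) b :=
    hD _ h.center_connected
  obtain ⟨ρ, -, hρ, hρ'⟩ := exists_radius hH
  have hC := (radius_eq_and_mem_center_iff hH hρ hρ').2
  obtain ⟨σ, hσr, hσ, c₀, hc₀⟩ := exists_radius h.center_connected
  obtain rfl : σ = 2 := by
    rw [h.center_radius] at hσr
    exact_mod_cast hσr.symm
  have hfar : ∀ a ∈ H.center, ∃ c : H.center, 2 ≤ H.dist a c := by
    intro a ha
    obtain ⟨c, hc⟩ := hσ ⟨a, ha⟩
    rw [hcd] at hc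
    exact ⟨c, hc⟩
  have hρ2 : ρ = 2 := by
    apply le_antisymm
    -- If the radius of `H` exceeded two, diameter three would make every vertex central, and `c₀`
    -- would be within two of all of them.
    · by_contra hlt
      have huniv : ∀ v, v ∈ H.center := fun v => (hC v).2 fun w => (h3 v w).trans (by omega)
      obtain ⟨w, hw⟩ := hρ c₀
      have := hc₀ ⟨w, huniv w⟩
      rw [hcd] at this
      exact hlt (hw.trans this)
    · obtain ⟨c, hc⟩ := hfar c₀ c₀.2
      exact hc.trans ((hC c₀).1 c₀.2 c)
  subst hρ2
  have hinr : ∀ s : H.center, ∃ w, 4 ≤ (H.pendant H.center).dist (Sum.inr s) w := by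
    intro s
    obtain ⟨c, hc⟩ := hfar s s.2
    refine ⟨Sum.inr c, ?_⟩
    rw [hdist]
    · simp only [pendant.base, pendant.height, Sum.elim_inr, Pi.one_apply]
      omega
    · rintro h
      rw [Sum.inr.inj h, dist_self] at hc
      omega
  have hinl : ∀ a w, (H.pendant H.center).dist (Sum.inl a) w ≤ 3 := by
    intro a w
    by_cases haw : Sum.inl a = w
    · rw [haw, dist_self]
      omega
    rw [hdist haw]
    rcases w with b | s
    · simpa [pendant.base, pendant.height] using h3 a b
    · have := (hC s).1 s.2 a
      rw [dist_comm] at this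
      simp only [pendant.base, pendant.height, Sum.elim_inr, Sum.elim_inl, id, Pi.one_apply,
        Pi.zero_apply]
      omega
  have hcen := (radius_eq_and_mem_center_iff hc (r := 3) ?_ ⟨Sum.inl c₀, hinl _⟩).2
  · let f : H ↪g H.pendant H.center := ⟨Function.Embedding.inl, Iff.rfl⟩
    refine nonempty_centerGraph_iso f fun v => ?_
    rw [hcen]
    rcases v with a | s
    · exact ⟨fun _ => ⟨a, rfl⟩, fun _ => hinl a⟩
    · constructor
      · intro hs
        obtain ⟨w, hw⟩ := hinr s
        exact absurd (hw.trans (hs w)) (by omega)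
      · rintro ⟨a, ha⟩
        cases ha
  · rintro (a | s)
    · by_cases ha : a ∈ H.center
      · obtain ⟨c, hc⟩ := hfar a ha
        refine ⟨Sum.inr c, ?_⟩
        rw [hdist (by simp)]
        simp only [pendant.base, pendant.height, Sum.elim_inr, Sum.elim_inl, id, Pi.one_apply,
          Pi.zero_apply]
        omega
      · rw [hC] at ha
        push Not at ha
        obtain ⟨b, hb⟩ := ha
        refine ⟨Sum.inl b, ?_⟩
        rw [hdist]
        · simpa [pendant.base, pendant.height] using Nat.succ_le_of_lt hb
        · rintro h
          rw [Sum.inl.inj h, dist_self] at hb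
          omega
    · obtain ⟨w, hw⟩ := hinr s
      exact ⟨w, by omega⟩

/-! ### The converse: cographs as centers -/

theorem IsCograph.induce {V : Type*} {G : SimpleGraph V} (h : G.IsCograph) (T : Set V) :
    (G.induce T).IsCograph :=
  fun h' => h (h'.trans ⟨Embedding.induce T⟩)

theorem IsCograph.dist_le_two {V : Type*} {G : SimpleGraph V} (h : G.IsCograph)
    (hG : G.Connected) (x y : V) : G.dist x y ≤ 2 := by
  rw [isCograph_iff] at h
  by_contra h3
  obtain ⟨n, hn⟩ : ∃ n, G.dist x y = n + 1 + 1 + 1 := ⟨G.dist x y - 3, by omega⟩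
  obtain ⟨a, ha, hn1⟩ := hG.exists_adj_dist_eq hn
  obtain ⟨b, hb, hn2⟩ := hG.exists_adj_dist_eq hn1
  obtain ⟨c, hc, hn3⟩ := hG.exists_adj_dist_eq hn2
  refine h x a b c ha hb hc ?_ ?_ ?_ <;> intro hadj <;>
    have := hG.dist_le_of_adj hadj y <;> omega

theorem IsCograph.isDistanceHereditary {V : Type*} {G : SimpleGraph V} (h : G.IsCograph)
    (hG : G.Connected) : G.IsDistanceHereditary := by
  intro T hT x y
  apply le_antisymm
  · have h2 := (h.induce T).dist_le_two hT x y
    by_cases h0 : G.dist (x : V) y = 0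
    · rw [hG.dist_eq_zero_iff] at h0
      rw [Subtype.ext h0, dist_self]
      omega
    by_cases h1 : G.dist (x : V) y = 1
    · have h1' := dist_eq_one_iff_adj.1 h1
      rw [h1, dist_eq_one_iff_adj.2 (show (G.induce T).Adj x y from h1')]
    · omega
  · exact Hom.dist_map_le (Embedding.induce T).toHom (hT x y)

/-- The graph `H` joined completely to two new non-adjacent vertices. -/
def joinTwo {W : Type u} (H : SimpleGraph W) : SimpleGraph (W ⊕ ULift.{u} Bool) :=
  (H ⊕g (⊥ : SimpleGraph (ULift.{u} Bool))) ⊔ completeBipartiteGraph W (ULift.{u} Bool)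

namespace joinTwo

variable {W : Type u} {H : SimpleGraph W}

theorem adj_inl_inl {a b : W} : H.joinTwo.Adj (.inl a) (.inl b) ↔ H.Adj a b := by
  simp [joinTwo]

theorem adj_inl_inr (a : W) (i : ULift Bool) : H.joinTwo.Adj (.inl a) (.inr i) := by
  simp [joinTwo]

theorem adj_inr_inl (a : W) (i : ULift Bool) : H.joinTwo.Adj (.inr i) (.inl a) := by
  simp [joinTwo]

theorem not_adj_inr_inr (i j : ULift Bool) : ¬ H.joinTwo.Adj (.inr i) (.inr j) := by
  simp [joinTwo]

theorem isCograph (h : H.IsCograph) : H.joinTwo.IsCograph := by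
  rw [isCograph_iff] at h ⊢
  rintro (a | i) (b | j) (c | k) (d | l) h1 h2 h3 h4 h5 h6
  · rw [adj_inl_inl] at h1 h2 h3 h4 h5 h6
    exact h a b c d h1 h2 h3 h4 h5 h6
  all_goals simp_all [adj_inl_inr, adj_inr_inl, not_adj_inr_inr]

theorem connected [Nonempty W] : H.joinTwo.Connected := by
  rw [connected_iff_exists_forall_reachable]
  refine ⟨.inr ⟨true⟩, ?_⟩
  rintro (a | i)
  · exact (adj_inr_inl a _).reachable
  · obtain ⟨w⟩ := ‹Nonempty W›
    exact (adj_inr_inl w _).reachable.trans (adj_inl_inr w _).reachable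

end joinTwo

/-- The join makes a possibly disconnected `H` part of a connected cograph. Vertices of `H` then
have eccentricity two, while each new vertex and its leaf are at distance at least three from the
leaf of the other new vertex. -/
theorem IsCograph.exists_centerGraph_iso {W : Type u} [Finite W] [Nonempty W]
    {H : SimpleGraph W} (h : H.IsCograph) :
    (H.joinTwo.pendant (Set.range Sum.inr)).Connected ∧
      (H.joinTwo.pendant (Set.range Sum.inr)).IsDistanceHereditary ∧
      Nonempty ((H.joinTwo.pendant (Set.range Sum.inr)).centerGraph ≃g H) := by
  have hJ : H.joinTwo.Connected := joinTwo.connected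
  have hJc := joinTwo.isCograph h
  have hJD := hJc.isDistanceHereditary hJ
  have hdist {u v} (huv : u ≠ v) := pendant.dist_eq (S := Set.range Sum.inr) hJ hJD huv
  have hc := pendant.connected (S := Set.range Sum.inr) hJ
  refine ⟨hc, pendant.isDistanceHereditary hJ hJD, ?_⟩
  have hll : ∀ a b : W, H.joinTwo.dist (.inl a) (.inl b) ≤ 2 := fun a b => hJc.dist_le_two hJ _ _
  have hlr : ∀ (a : W) i, H.joinTwo.dist (.inl a) (.inr i) = 1 := fun a i =>
    dist_eq_one_iff_adj.2 (joinTwo.adj_inl_inr a i)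
  have hrr : ∀ i : ULift Bool, 2 ≤ H.joinTwo.dist (.inr i) (.inr ⟨!i.down⟩) := fun i =>
    hJ.one_lt_dist_of_ne_of_not_adj
      (fun hi => by simpa using congrArg ULift.down (Sum.inr.inj hi))
      (joinTwo.not_adj_inr_inr _ _)
  have hfar : ∀ u : (W ⊕ ULift Bool) ⊕ (Set.range Sum.inr : Set (W ⊕ ULift Bool)), ∀ i,
      pendant.base u = Sum.inr i →
      ∃ w, 3 ≤ (H.joinTwo.pendant (Set.range Sum.inr)).dist u w := by
    intro u i hu
    refine ⟨Sum.inr ⟨.inr ⟨!i.down⟩, ⟨_, rfl⟩⟩, ?_⟩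
    have := hrr i
    rw [hdist, hu]
    · simp only [pendant.base, pendant.height, Sum.elim_inr, Pi.one_apply]
      omega
    · rintro rfl
      simp only [pendant.base, Sum.elim_inr] at hu
      simpa using congrArg ULift.down (Sum.inr.inj hu)
  have hnear : ∀ a w, (H.joinTwo.pendant (Set.range Sum.inr)).dist (Sum.inl (Sum.inl a)) w
      ≤ 2 := by
    intro a w
    by_cases haw : Sum.inl (Sum.inl a) = w
    · rw [haw, dist_self]
      omega
    rw [hdist haw]
    rcases w with (b | i) | ⟨_, i, rfl⟩
    · simpa [pendant.base, pendant.height] using hll a b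
    · simp [pendant.base, pendant.height, hlr]
    · simp [pendant.base, pendant.height, hlr]
  obtain ⟨a₀⟩ := ‹Nonempty W›
  have hcen := (radius_eq_and_mem_center_iff hc (r := 2) ?_ ⟨Sum.inl (Sum.inl a₀), hnear _⟩).2
  · let f : H ↪g H.joinTwo.pendant (Set.range Sum.inr) :=
      ⟨⟨fun a => Sum.inl (Sum.inl a), fun a b hab => Sum.inl.inj (Sum.inl.inj hab)⟩,
        joinTwo.adj_inl_inl⟩
    have hnot : ∀ u i, pendant.base u = Sum.inr i →
        (u ∈ (H.joinTwo.pendant (Set.range Sum.inr)).center ↔ u ∈ Set.range f) := by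
      intro u i hu
      obtain ⟨w, hw⟩ := hfar u i hu
      rw [hcen]
      constructor
      · intro hs
        exact absurd (hw.trans (hs w)) (by omega)
      · rintro ⟨a, rfl⟩
        cases hu
    refine nonempty_centerGraph_iso f fun v => ?_
    rcases v with (a | i) | ⟨_, i, rfl⟩
    · rw [hcen]
      exact ⟨fun _ => ⟨a, rfl⟩, fun _ => hnear a⟩
    · exact hnot _ i rfl
    · exact hnot _ i rfl
  · rintro ((a | i) | ⟨_, i, rfl⟩)
    · refine ⟨Sum.inr ⟨.inr ⟨true⟩, ⟨_, rfl⟩⟩, ?_⟩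
      rw [hdist (by simp)]
      simp [pendant.base, pendant.height, hlr]
    · obtain ⟨w, hw⟩ := hfar (Sum.inl (Sum.inr i)) i rfl
      exact ⟨w, by omega⟩
    · obtain ⟨w, hw⟩ := hfar (Sum.inr ⟨.inr i, ⟨_, rfl⟩⟩) i rfl
      exact ⟨w, by omega⟩

end SimpleGraph

theorem mainTheorem2 :
    (∀ (V : Type u) [Finite V] (G : SimpleGraph V), G.Connected → G.IsDistanceHereditary →
      G.centerGraph.IsCograph ∨ G.centerGraph.IsDiamThreeKind) ∧
    (∀ (W : Type u) [Finite W] [Nonempty W] (H : SimpleGraph W),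
      H.IsCograph ∨ H.IsDiamThreeKind →
      ∃ (V : Type u) (_ : Finite V) (G : SimpleGraph V),
        G.Connected ∧ G.IsDistanceHereditary ∧ Nonempty (G.centerGraph ≃g H)) := by
  refine ⟨fun V _ G hG hD => ?_, fun W _ _ H hH => ?_⟩
  · by_cases h : G.centerGraph.IsCograph
    · exact Or.inl h
    · exact Or.inr (hD.centerGraph_isDiamThreeKind hG h)
  · rcases hH with h | h
    · exact ⟨_, inferInstance, _, h.exists_centerGraph_iso⟩
    · exact ⟨_, inferInstance, _, h.exists_centerGraph_iso⟩
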